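/- **Model.** Let $N$ (students), $M$ (colleges) and $F$ (features) be finite sets. An instance consists of capacities $x_c\in\mathbb{Z}_{>0}$ ($c\in M$), a strict total order $\succ_c$ on $N$ for each $c\in M$, and, for each student $s\in N$, utility functions $u_s=(u_s^f)_{f\in F}$, $u_s^f:M\to[0,1]$, and a probability distribution $\mu_s$ on the weight vectors $\{w\in\mathbb{R}_{\ge 0}^F:\sum_f w^f=1\}$. Given $w$, student $s$ has $c\succeq_s^{w}c'$ iff $\sum_f w^fu_s^f(c)\ge\sum_f w^fu_s^f(c')$, with strict part $\succ_s^w$; every college is strictly better than being unmatched ($\mathsf{null}$). Probabilities $\Pr[\cdot]$ are over $w\sim\mu_s$. **GDA.** Generalized student-proposing deferred acceptance starts with all students unmatched and $R_s=\emptyset$ for all $s$, where $R_s$ is the set of colleges that have rejected $s$. While some unmatched student has $R_s\ne M$, all such students simultaneously propose, $s$ to the college $\mathsf{Next}(s,R_s,u_s,\mu_s)\notin R_s$; each college $c$ keeps its $x_c$ most preferred students (all, if there are at most $x_c$) among its current students and its new proposers, and rejects the others, who become (or stay) unmatched and add $c$ to their $R_s$. The output is the final matching. **LOICV.** For $c\in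 M\setminus R$ let $\tilde q_s(c,R)$ be the vector of the probabilities $\Pr[c\succeq_s^{w}c']$, $c'\in M\setminus R$, $c'\neq c$, arranged in ascending order. The LOICV rule lets $\mathsf{Next}(s,R,u_s,\mu_s)$ be a college $c\in M\setminus R$ for which $\tilde q_s(c,R)$ is lexicographically maximal among the colleges of $M\setminus R$, ties being broken in any predetermined way (which may depend on $s,R,u_s,\mu_s$). **Theorem.** If $|F|=2$, then GDA with the LOICV rule, with any such tie-breaking, is incentive compatible with rationality (IC-R): for every instance, every student $s$, and every misreport $(u_s',\mu_s')$, if $\pi(s)\in M\cup\{\mathsf{null}\}$ is the assignment of $s$ when she reports $(u_s,\mu_s)$ and $\pi'(s)\in M\cup\{\mathsf{null}\}$ is her assignment when she reports $(u'_s,\mu'_s)$, all else unchanged, then $$\Pr_{w\sim\mu_s}\big[\pi'(s)\succ_s^{w}\pi(s)\big]\le \tfrac12,$$ where $\succ_s^w$ is defined from the true utilities $u_s$. -/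

import Mathlib

namespace SchoolChoice

open MeasureTheory

/-- Weight vectors: nonnegative vectors indexed by the features, with sum `1`. -/
abbrev Weights (F : Type*) [Fintype F] : Type _ := stdSimplex ℝ F

/-- The utility functions of one student: one function from colleges to `[0,1]` per feature. -/
abbrev Utilities (M F : Type*) : Type _ := F → M → Set.Icc (0 : ℝ) 1

/-- An instance of school choice with feature-based uncertain preferences, with students `N`,
colleges `M` and features `F`. -/
structure Instance (N M F : Type*) [Fintype F] where
  /-- capacities of the colleges -/
  capacity : M → ℕ
  capacity_pos : ∀ c, 0 < capacity c
  /-- `prefers c s s'`: college `c` strictly prefers student `s` to student `s'` -/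
  prefers : M → N → N → Prop
  prefers_strict : ∀ c, IsStrictTotalOrder N (prefers c)
  /-- the utility functions of each student -/
  utility : N → Utilities M F
  /-- the weight distribution of each student -/
  dist : N → ProbabilityMeasure (Weights F)

section Preferences

variable {M F : Type*} [Fintype F]

/-- The weighted utility of college `c` under the weight vector `w`. -/
def weightedUtility (u : Utilities M F) (w : Weights F) (c : M) : ℝ :=
  ∑ f, (w : F → ℝ) f * (u f c : ℝ)

/-- The probability that college `c` is weakly preferred to college `c'`. -/
noncomputable def probWeaklyPrefers (u : Utilities M F) (μ : ProbabilityMeasure (Weights F))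
    (c c' : M) : ℝ :=
  (μ : Measure (Weights F)).real {w | weightedUtility u w c' ≤ weightedUtility u w c}

/-- Strict preference between assignments under the weight vector `w`, where `none` means being
unmatched. Every college is acceptable, so it is strictly better than being unmatched. -/
def StrictlyBetter (u : Utilities M F) (w : Weights F) : Option M → Option M → Prop
  | some c, some c' => weightedUtility u w c' < weightedUtility u w c
  | some _, none => True
  | none, _ => False

end Preferences

section Algorithms

variable {N M F : Type*} [Fintype F]

/-- A matching, given by the college of each student (`none` for an unmatched student). -/
abbrev Matching (N M : Type*) : Type _ := N → Option M

open Classical in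
/-- The instance after student `s` replaces her report by the utilities `u'` and the weight
distribution `μ'`. -/
noncomputable def Instance.misreport (I : Instance N M F) (s : N) (u' : Utilities M F)
    (μ' : ProbabilityMeasure (Weights F)) : Instance N M F :=
  { I with
    utility := Function.update I.utility s u'
    dist := Function.update I.dist s μ' }

/-- Incentive compatibility with rationality: in no instance can a student, by misreporting her
utilities and her weight distribution, obtain a college that is strictly better than her truthful
assignment with probability (under her true utilities and weight distribution) more than `1/2`. -/
def IsICR (Alg : Instance N M F → Matching N M) : Prop :=
  ∀ (I : Instance N M F) (s : N) (u' : Utilities M F) (μ' : ProbabilityMeasure (Weights F)),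
    ¬ (1 / 2 < (I.dist s : Measure (Weights F)).real
      {w | StrictlyBetter (I.utility s) w (Alg (I.misreport s u' μ') s) (Alg I s)})

end Algorithms

section DeferredAcceptance

variable {N M F : Type*} [Fintype N] [Fintype M] [Fintype F]

/-- A rule `Next(s, R, u, μ)` giving the college to which student `s` proposes when `R` is the set
of colleges that have rejected her. It is only consulted for `R ≠ univ`. -/
abbrev NextRule (N M F : Type*) [Fintype F] : Type _ :=
  N → Finset M → Utilities M F → ProbabilityMeasure (Weights F) → Option M

/-- The state of generalized deferred acceptance between two rounds. -/
structure GDAState (N M : Type*) where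
  /-- the current matching -/
  matching : Matching N M
  /-- for each student, the set of colleges that have rejected her -/
  rejected : N → Finset M

/-- Before the first round, nobody is matched and nobody has been rejected. -/
def GDAState.init (N M : Type*) : GDAState N M := ⟨fun _ => none, fun _ => ∅⟩

/-- A student proposes in the coming round iff she is unmatched and some college has not yet
rejected her. -/
def GDAState.Active (σ : GDAState N M) (s : N) : Prop :=
  σ.matching s = none ∧ σ.rejected s ≠ Finset.univ

open Classical in
/-- The college that holds or receives the application of `s` in the coming round, if any: her
current college if she is matched, the college she proposes to if she is active. -/
noncomputable def GDAState.applied (next : NextRule N M F) (I : Instance N M F)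
    (σ : GDAState N M) (s : N) : Option M :=
  if σ.Active s then next s (σ.rejected s) (I.utility s) (I.dist s) else σ.matching s

open Classical in
/-- Student `s` is among the `capacity c` most preferred students for college `c` within the set of
students currently matched with or proposing to `c` (all of them if they do not exceed the
capacity). -/
def GDAState.Accepted (next : NextRule N M F) (I : Instance N M F) (σ : GDAState N M)
    (c : M) (s : N) : Prop :=
  σ.applied next I s = some c ∧
    (Finset.univ.filter
      (fun s' => σ.applied next I s' = some c ∧ I.prefers c s' s)).card < I.capacity c

open Classical in
/-- One round: all active students propose simultaneously, each college keeps its most preferred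
students up to its capacity, and rejects the others. -/
noncomputable def GDAState.round (next : NextRule N M F) (I : Instance N M F)
    (σ : GDAState N M) : GDAState N M where
  matching s := (σ.applied next I s).filter (fun c => decide (σ.Accepted next I c s))
  rejected s := σ.rejected s ∪
    Finset.univ.filter (fun c => σ.applied next I s = some c ∧ ¬ σ.Accepted next I c s)

/-- The state after `k` rounds. -/
noncomputable def gdaState (next : NextRule N M F) (I : Instance N M F) (k : ℕ) : GDAState N M :=
  (GDAState.round next I)^[k] (GDAState.init N M)

/-- Every proposal goes to a college that has not yet rejected the student. -/
def NextRule.Valid (next : NextRule N M F) : Prop :=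
  ∀ s R u μ, R ≠ Finset.univ → ∃ c, c ∉ R ∧ next s R u μ = some c

theorem gdaState_succ (next : NextRule N M F) (I : Instance N M F) (k : ℕ) :
    gdaState next I (k + 1) = (gdaState next I k).round next I := by
  simp only [gdaState, Function.iterate_succ_apply']

theorem GDAState.round_of_accepted (next : NextRule N M F) (I : Instance N M F)
    (σ : GDAState N M) {s : N} {c : M} (h : σ.Accepted next I c s) :
    (σ.round next I).matching s = some c ∧ (σ.round next I).rejected s = σ.rejected s := by
  classical
  have ha := h.1
  refine ⟨by simp [GDAState.round, ha, h], ?_⟩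
  ext c'
  simp only [GDAState.round, Finset.mem_union, Finset.mem_filter, Finset.mem_univ, true_and, ha,
    Option.some.injEq, or_iff_left_iff_imp]
  rintro ⟨rfl, h'⟩
  exact absurd h h'

open Classical in
theorem GDAState.round_of_not_accepted (next : NextRule N M F) (I : Instance N M F)
    (σ : GDAState N M) {s : N} {c : M} (ha : σ.applied next I s = some c)
    (h : ¬ σ.Accepted next I c s) :
    (σ.round next I).matching s = none ∧
      (σ.round next I).rejected s = σ.rejected s ∪ {c} := by
  refine ⟨by simp [GDAState.round, ha, h], ?_⟩
  ext c'
  simp only [GDAState.round, Finset.mem_union, Finset.mem_filter, Finset.mem_univ, true_and, ha,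
    Option.some.injEq, Finset.mem_singleton]
  constructor
  · rintro (h1 | ⟨rfl, -⟩)
    · exact Or.inl h1
    · exact Or.inr rfl
  · rintro (h1 | rfl)
    · exact Or.inl h1
    · exact Or.inr ⟨rfl, h⟩

theorem GDAState.round_of_none (next : NextRule N M F) (I : Instance N M F)
    (σ : GDAState N M) {s : N} (ha : σ.applied next I s = none) :
    (σ.round next I).matching s = none ∧ (σ.round next I).rejected s = σ.rejected s := by
  classical
  refine ⟨by simp [GDAState.round, ha], ?_⟩
  ext c'
  simp [GDAState.round, ha]

open Classical in
/-- Colleges never exceed their capacities. -/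
theorem gdaState_capacity (next : NextRule N M F) (I : Instance N M F) (k : ℕ) (s : N) (c : M)
    (h : (gdaState next I k).matching s = some c) :
    (Finset.univ.filter (fun s' => (gdaState next I k).matching s' = some c ∧
      I.prefers c s' s)).card < I.capacity c := by
  cases k with
  | zero => simp [gdaState, GDAState.init] at h
  | succ k =>
    rw [gdaState_succ] at h ⊢
    simp only [GDAState.round, Option.filter_eq_some_iff, decide_eq_true_eq] at h ⊢
    refine lt_of_le_of_lt (Finset.card_le_card ?_) h.2.2
    intro s' hs'
    simp only [Finset.mem_filter, Finset.mem_univ, true_and] at hs' ⊢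
    exact ⟨hs'.1.1, hs'.2⟩

/-- After the end of the loop, further rounds change nothing. -/
theorem GDAState.round_eq_self (next : NextRule N M F) (I : Instance N M F) (k : ℕ)
    (h : ∀ s, ¬ (gdaState next I k).Active s) :
    gdaState next I (k + 1) = gdaState next I k := by
  classical
  have happ : ∀ s, (gdaState next I k).applied next I s = (gdaState next I k).matching s :=
    fun s => by simp [GDAState.applied, h s]
  have hacc : ∀ s c, (gdaState next I k).matching s = some c →
      (gdaState next I k).Accepted next I c s := by
    intro s c hs
    refine ⟨by rw [happ, hs], ?_⟩
    simp only [happ]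
    exact gdaState_capacity next I k s c hs
  have key : ∀ s, (gdaState next I (k + 1)).matching s = (gdaState next I k).matching s ∧
      (gdaState next I (k + 1)).rejected s = (gdaState next I k).rejected s := by
    intro s
    rw [gdaState_succ]
    rcases hs : (gdaState next I k).matching s with _ | c
    · exact GDAState.round_of_none next I _ (by rw [happ, hs])
    · exact GDAState.round_of_accepted next I _ (hacc s c hs)
  rcases h1 : gdaState next I (k + 1) with ⟨m1, r1⟩
  rcases h2 : gdaState next I k with ⟨m2, r2⟩
  rw [h1, h2] at key
  congr 1
  · exact funext fun s => (key s).1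
  · exact funext fun s => (key s).2

/-- No student is matched with, or applies to, a college that has rejected her before. -/
theorem gdaState_applied_not_rejected {next : NextRule N M F} (hv : next.Valid)
    (I : Instance N M F) (k : ℕ) :
    (∀ s c, (gdaState next I k).matching s = some c → c ∉ (gdaState next I k).rejected s) ∧
    ∀ s c, (gdaState next I k).applied next I s = some c →
      c ∉ (gdaState next I k).rejected s := by
  classical
  have step : ∀ σ : GDAState N M, (∀ s c, σ.matching s = some c → c ∉ σ.rejected s) →
      ∀ s c, σ.applied next I s = some c → c ∉ σ.rejected s := by
    intro σ hσ s c hc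
    by_cases hact : σ.Active s
    · obtain ⟨c', hc', he⟩ := hv s (σ.rejected s) (I.utility s) (I.dist s) hact.2
      simp only [GDAState.applied, hact, if_true, he, Option.some.injEq] at hc
      exact hc ▸ hc'
    · simp only [GDAState.applied, hact, if_false] at hc
      exact hσ s c hc
  suffices h : ∀ s c, (gdaState next I k).matching s = some c →
      c ∉ (gdaState next I k).rejected s from ⟨h, step _ h⟩
  induction k with
  | zero => intro s c h; simp [gdaState, GDAState.init] at h
  | succ k ih =>
    intro s c h
    rw [gdaState_succ] at h ⊢
    have h' := h
    simp only [GDAState.round, Option.filter_eq_some_iff, decide_eq_true_eq] at h'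
    rw [(GDAState.round_of_accepted next I _ h'.2).2]
    exact step _ ih s c h'.1

open Classical in
/-- With a valid rule, the loop ends after at most `|N| * |M|` rounds. -/
theorem gda_terminates {next : NextRule N M F} (hv : next.Valid) (I : Instance N M F) (s : N) :
    ¬ (gdaState next I (Fintype.card N * Fintype.card M)).Active s := by
  let p : ℕ → N → ℕ := fun k s => ((gdaState next I k).rejected s).card +
    if (gdaState next I k).matching s = none then 0 else 1
  have hstep : ∀ k s, p k s + (if (gdaState next I k).Active s then 1 else 0) ≤ p (k + 1) s := by
    intro k s
    simp only [p]
    rw [gdaState_succ]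
    rcases ha : (gdaState next I k).applied next I s with _ | c
    · have hna : ¬ (gdaState next I k).Active s := by
        intro hact
        obtain ⟨c', -, he⟩ := hv s _ (I.utility s) (I.dist s) hact.2
        simp [GDAState.applied, hact, he] at ha
      have hm : (gdaState next I k).matching s = none := by
        simpa [GDAState.applied, hna] using ha
      simp [GDAState.round_of_none next I _ ha, hna, hm]
    · have hlt : (if (gdaState next I k).matching s = none then 0 else 1) +
          (if (gdaState next I k).Active s then 1 else 0) ≤ 1 := by
        by_cases hm : (gdaState next I k).matching s = none
        · simp only [hm, if_true]; split_ifs <;> simp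
        · simp [GDAState.Active, hm]
      by_cases h : (gdaState next I k).Accepted next I c s
      · rw [(GDAState.round_of_accepted next I _ h).1, (GDAState.round_of_accepted next I _ h).2]
        simp only [reduceCtorEq, if_false]
        omega
      · rw [(GDAState.round_of_not_accepted next I _ ha h).1,
          (GDAState.round_of_not_accepted next I _ ha h).2, Finset.card_union_of_disjoint
          (by simpa using (gdaState_applied_not_rejected hv I k).2 s c ha)]
        simp only [Finset.card_singleton, if_true]
        omega
  have hsum : ∀ k, (∀ s, ¬ (gdaState next I k).Active s) ∨ k ≤ ∑ s, p k s := by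
    intro k
    induction k with
    | zero => exact Or.inr (Nat.zero_le _)
    | succ k ih =>
      by_cases hk : ∀ s, ¬ (gdaState next I k).Active s
      · left; rwa [GDAState.round_eq_self next I k hk]
      · right
        have h1 := ih.resolve_left hk
        push Not at hk
        obtain ⟨s, hs⟩ := hk
        have : ∑ s, p k s < ∑ s, p (k + 1) s :=
          Finset.sum_lt_sum (fun s _ => le_trans (Nat.le_add_right _ _) (hstep k s))
            ⟨s, Finset.mem_univ _, by have := hstep k s; simp only [hs, if_true] at this; omega⟩
        omega
  intro hact
  have hbig := (hsum _).resolve_left (fun h => h s hact)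
  have hle : ∀ s, p (Fintype.card N * Fintype.card M) s ≤ Fintype.card M := by
    intro s
    simp only [p]
    split_ifs with hm
    · simpa using Finset.card_le_univ _
    · obtain ⟨c, hc⟩ := Option.ne_none_iff_exists'.1 hm
      exact Finset.card_lt_univ_of_notMem ((gdaState_applied_not_rejected hv I _).1 s c hc)
  have hlt : p (Fintype.card N * Fintype.card M) s < Fintype.card M := by
    simp only [p, hact.1, if_true, add_zero]
    exact lt_of_le_of_ne (Finset.card_le_univ _) 
      (fun h => hact.2 ((Finset.card_eq_iff_eq_univ _).1 h))
  have : ∑ s, p (Fintype.card N * Fintype.card M) s < ∑ _s : N, Fintype.card M :=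
    Finset.sum_lt_sum (fun s _ => hle s) ⟨s, Finset.mem_univ _, hlt⟩
  simp at this
  omega

/-- Generalized student-proposing deferred acceptance. The loop runs while there is an active
student; `|N| * |M|` rounds always reach its end, see `gda_terminates`, and rounds after the end
change nothing, see `GDAState.round_eq_self`. -/
noncomputable def GDA (next : NextRule N M F) (I : Instance N M F) : Matching N M :=
  (gdaState next I (Fintype.card N * Fintype.card M)).matching

open Classical in
/-- The iterated comparison vector of college `c`: the probabilities that `c` is weakly preferred to
each other college outside `R`, in ascending order. -/
noncomputable def iteratedComparisonVector (u : Utilities M F) (μ : ProbabilityMeasure (Weights F))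
    (R : Finset M) (c : M) : List ℝ :=
  ((Finset.univ.filter (fun c' => c' ∉ R ∧ c' ≠ c)).val.map (probWeaklyPrefers u μ c)).sort (· ≤ ·)

/-- `next` follows the rule of the lexicographic order of iterated comparison vectors, with some
tie-breaking: it picks a college outside `R` whose iterated comparison vector is lexicographically
maximal among the colleges outside `R`. -/
def IsLOICV (next : NextRule N M F) : Prop :=
  ∀ s R u μ, R ≠ Finset.univ → ∃ c, c ∉ R ∧ next s R u μ = some c ∧
    ∀ c', c' ∉ R → ¬ List.Lex (· < ·) (iteratedComparisonVector u μ R c)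
      (iteratedComparisonVector u μ R c')

end DeferredAcceptance

theorem IsLOICV.valid {N M F : Type*} [Fintype M] [Fintype F] {next : NextRule N M F}
    (h : IsLOICV next) : next.Valid := by
  intro s R u μ hR
  obtain ⟨c, hc, he, -⟩ := h s R u μ hR
  exact ⟨c, hc, he⟩

end SchoolChoice

/-! The colleges that have rejected a student determine her next proposal. For a fixed report her
proposals therefore form a fixed list, `plan`, and GDA is ordinary deferred acceptance on these
lists (`exists_isLeast_GDA_eq_held`). Deferred acceptance is strategyproof: a misreport never yields
a college that rejected the student when she was truthful (`ne_held_of_isLeast`). So a college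
gained by misreporting was still available when she truthfully proposed to her final college, and it
remains to see that no available college beats the LOICV choice with probability above 1/2.

Here two features matter. With weights (t, 1 - t), the utility difference of two colleges is affine
in t; if it is nonnegative at a median of t, it is nonnegative on a half-line of probability at
least 1/2. Hence the best college at the median weight is weakly preferred to each rival with
probability at least 1/2 (`exists_half_le_probWeaklyPrefers`). Comparison vectors start with their
least entry, so the lexicographic maximum inherits this bound.

For strategyproofness, matchings are encoded by the number of rejections of each student. Deferred
acceptance reaches the least stable vector, and a student matched there is matched in every stable
matching (`held_ne_none_of_isLeast`). Applying this to a list consisting of one college gives the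
claim. -/

namespace SchoolChoice

open MeasureTheory

/-! ### Deferred acceptance on fixed rankings: optimality, rural hospitals, strategyproofness. -/

section DeferredAcceptanceWithRankings

-- Otherwise an `r`-minimal element outside the filtered set has all its predecessors inside it,
-- hence fewer than `n` of them, and would belong to it. Used to see that the best applicants of an
-- overdemanded college survive a round.
open Classical in
theorem le_card_filter_card_filter_lt {N : Type*} (r : N → N → Prop) [IsStrictTotalOrder N r] (B : Finset N)
    {n : ℕ} (h : n ≤ B.card) :
    n ≤ (B.filter fun x => (B.filter fun y => r y x).card < n).card := by
  by_contra hlt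
  set G := B.filter fun x => (B.filter fun y => r y x).card < n
  have hGB : G ⊆ B := Finset.filter_subset _ _
  have hne : (B \ G).Nonempty := by
    rw [← Finset.card_pos, Finset.card_sdiff_of_subset hGB]
    omega
  have hwf : ((B \ G : Finset N) : Set N).WellFoundedOn r := (Finset.finite_toSet _).wellFoundedOn
  obtain ⟨x, hx, hmin⟩ := hwf.has_min (Set.univ : Set ((B \ G : Finset N) : Set N))
    ⟨⟨hne.choose, hne.choose_spec⟩, trivial⟩
  have hxB := Finset.mem_sdiff.1 x.2
  apply hxB.2
  refine Finset.mem_filter.2 ⟨hxB.1, lt_of_le_of_lt (Finset.card_le_card ?_) (not_le.1 hlt)⟩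
  intro y hy
  rw [Finset.mem_filter] at hy
  by_contra hyG
  exact hmin ⟨y, Finset.mem_sdiff.2 ⟨hy.1, hyG⟩⟩ trivial hy.2

/-- Every ranking is finite: it ends at its first `none`, before some common index. -/
structure IsRanking {N M : Type*} (p : N → ℕ → Option M) : Prop where
  succ_eq_none : ∀ s i, p s i = none → p s (i + 1) = none
  exists_bound : ∃ b, ∀ s i, b ≤ i → p s i = none

theorem IsRanking.eq_none_of_le {N M : Type*} {p : N → ℕ → Option M} (hp : IsRanking p) {s : N} {i j : ℕ}
    (hij : i ≤ j) (h : p s i = none) : p s j = none := by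
  induction j, hij using Nat.le_induction with
  | base => exact h
  | succ j _ ih => exact hp.succ_eq_none s j ih

variable {N M : Type*} [Fintype N]

open Classical in
/-- At least `q c` of the students that `a` sends to `c` are preferred by `c` to `s`. -/
def Overdemanded (q : M → ℕ) (r : M → N → N → Prop) (a : N → Option M) (c : M) (s : N) : Prop :=
  q c ≤ (Finset.univ.filter fun s' => a s' = some c ∧ r c s' s).card

/-- The college to which each student applies after `k s` rejections, where `p s i` is the
`i`-th entry of her ranking. -/
def held (p : N → ℕ → Option M) (k : N → ℕ) : N → Option M := fun s => p s (k s)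

/-- The numbers `k s` of rejections describe a stable matching for the rankings `p`. -/
structure IsStable (q : M → ℕ) (r : M → N → N → Prop) (p : N → ℕ → Option M)
    (k : N → ℕ) : Prop where
  rejected : ∀ s i c, i < k s → p s i = some c → Overdemanded q r (held p k) c s
  accepted : ∀ s c, held p k s = some c → ¬ Overdemanded q r (held p k) c s

open Classical in
/-- One round of deferred acceptance: every overdemanded application is rejected. -/
noncomputable def advance (q : M → ℕ) (r : M → N → N → Prop) (p : N → ℕ → Option M)
    (k : N → ℕ) : N → ℕ :=
  fun s => k s + if ∃ c, held p k s = some c ∧ Overdemanded q r (held p k) c s then 1 else 0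

variable {q : M → ℕ} {r : M → N → N → Prop} {p : N → ℕ → Option M} {k m : N → ℕ}

theorem Overdemanded.mono {a b : N → Option M} {c : M} {s t : N}
    (h : Overdemanded q r a c s)
    (hab : ∀ s', a s' = some c → r c s' s → b s' = some c ∧ r c s' t) :
    Overdemanded q r b c t := by
  classical
  refine le_trans h (Finset.card_le_card fun x hx => ?_)
  simp only [Finset.mem_filter, Finset.mem_univ, true_and] at hx ⊢
  exact hab x hx.1 hx.2

theorem advance_of_overdemanded {s : N} {c : M} (hc : held p k s = some c)
    (h : Overdemanded q r (held p k) c s) : advance q r p k s = k s + 1 := by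
  rw [advance, if_pos ⟨c, hc, h⟩]

theorem advance_of_not_overdemanded {s : N} {c : M} (hc : held p k s = some c)
    (h : ¬ Overdemanded q r (held p k) c s) : advance q r p k s = k s := by
  rw [advance, if_neg, add_zero]
  rintro ⟨c', hc', h'⟩
  rw [hc] at hc'
  cases hc'
  exact h h'

theorem advance_of_none {s : N} (hc : held p k s = none) : advance q r p k s = k s := by
  simp [advance, hc]

/-- The best `q c` of the applicants who outrank `s` are not rejected themselves, so they still hold
`c` after the round. -/
theorem Overdemanded.advance (hr : ∀ c, IsStrictTotalOrder N (r c)) {c : M} {s : N}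
    (h : Overdemanded q r (held p k) c s) :
    Overdemanded q r (held p (advance q r p k)) c s := by
  classical
  have := hr c
  refine le_trans (le_card_filter_card_filter_lt (r c) _ h) (Finset.card_le_card fun x hx => ?_)
  simp only [Finset.mem_filter, Finset.mem_univ, true_and] at hx ⊢
  refine ⟨?_, hx.1.2⟩
  rw [held, advance_of_not_overdemanded hx.1.1]
  · exact hx.1.1
  · rw [Overdemanded, not_le]
    refine lt_of_le_of_lt (Finset.card_le_card fun y hy => ?_) hx.2
    simp only [Finset.mem_filter, Finset.mem_univ, true_and] at hy ⊢
    exact ⟨⟨hy.1, _root_.trans hy.2 hx.1.2⟩, hy.2⟩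

/-- The first student to overtake `m` would be rejected by her college in `m`. Each applicant who
beats her there either holds that college in `m` too, or has passed it; in the latter case the
college is overdemanded in `m` for that applicant, hence for her as well. -/
theorem advance_le_of_isStable (hr : ∀ c, IsStrictTotalOrder N (r c)) (hm : IsStable q r p m)
    (hkm : k ≤ m) : advance q r p k ≤ m := by
  intro s
  rcases (hkm s).lt_or_eq with hlt | heq
  · rw [advance]
    split_ifs
    · exact hlt
    · exact hkm s
  · rcases hc : held p k s with _ | c
    · rw [advance_of_none hc]
      exact hkm s
    · by_cases ho : Overdemanded q r (held p k) c s
      · exfalso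
        have := hr c
        have hcm : held p m s = some c := by rw [held, ← heq]; exact hc
        refine hm.accepted s c hcm (ho.mono fun x hx hxs => ⟨?_, hxs⟩)
        rcases (hkm x).lt_or_eq with hxlt | hxeq
        · exact absurd ((hm.rejected x _ c hxlt hx).mono
            fun y hy hyx => ⟨hy, _root_.trans hyx hxs⟩) (hm.accepted s c hcm)
        · rw [held, ← hxeq]
          exact hx
      · rw [advance_of_not_overdemanded hc ho]
        exact hkm s

theorem iterate_advance_le_of_isStable (hr : ∀ c, IsStrictTotalOrder N (r c))
    (hm : IsStable q r p m) (n : ℕ) : (advance q r p)^[n] 0 ≤ m := by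
  induction n with
  | zero => exact fun s => Nat.zero_le _
  | succ n ih =>
    rw [Function.iterate_succ_apply']
    exact advance_le_of_isStable hr hm ih

theorem overdemanded_iterate_advance (hr : ∀ c, IsStrictTotalOrder N (r c)) (n : ℕ) (s : N)
    (i : ℕ) (c : M) (hi : i < (advance q r p)^[n] 0 s) (hc : p s i = some c) :
    Overdemanded q r (held p ((advance q r p)^[n] 0)) c s := by
  induction n with
  | zero => simp at hi
  | succ n ih =>
    rw [Function.iterate_succ_apply'] at hi ⊢
    refine Overdemanded.advance hr ?_
    by_cases hlt : i < (SchoolChoice.advance q r p)^[n] 0 s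
    · exact ih hlt
    · rw [SchoolChoice.advance] at hi
      split_ifs at hi with h
      · obtain ⟨c', hc', h'⟩ := h
        have : i = (SchoolChoice.advance q r p)^[n] 0 s := by omega
        rw [held, ← this, hc] at hc'
        cases hc'
        exact h'
      · omega

/-- When no application is rejected any more, deferred acceptance has reached the least stable
vector of rejection numbers, that is, the student-optimal stable matching. -/
theorem isLeast_isStable_iterate_advance (hr : ∀ c, IsStrictTotalOrder N (r c)) {n : ℕ}
    (h : ∀ s c, held p ((advance q r p)^[n] 0) s = some c →
      ¬ Overdemanded q r (held p ((advance q r p)^[n] 0)) c s) :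
    IsLeast {k | IsStable q r p k} ((advance q r p)^[n] 0) :=
  ⟨⟨overdemanded_iterate_advance hr n, h⟩,
    fun _ hm => iterate_advance_le_of_isStable hr hm n⟩

theorem exists_isLeast_isStable (hr : ∀ c, IsStrictTotalOrder N (r c)) (hp : IsRanking p) :
    ∃ k, IsLeast {k | IsStable q r p k} k := by
  obtain ⟨b, hb⟩ := hp.exists_bound
  have hle : ∀ n s, (advance q r p)^[n] 0 s ≤ b := by
    intro n s
    induction n with
    | zero => simp
    | succ n ih =>
      rw [Function.iterate_succ_apply', advance]
      split_ifs with h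
      · obtain ⟨c, hc, -⟩ := h
        by_contra hlt
        rw [held, hb s _ (by omega)] at hc
        cases hc
      · exact ih
  by_contra hno
  -- Without a fixed point the total number of rejections grows in every round, yet it is at most
  -- `b` per student.
  have hsum : ∀ n, n ≤ ∑ s, (advance q r p)^[n] 0 s := by
    intro n
    induction n with
    | zero => exact Nat.zero_le _
    | succ n ih =>
      have h : ∃ s c, held p ((advance q r p)^[n] 0) s = some c ∧
          Overdemanded q r (held p ((advance q r p)^[n] 0)) c s := by
        by_contra h
        push Not at h
        exact hno ⟨_, isLeast_isStable_iterate_advance hr h⟩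
      obtain ⟨s, c, hc, ho⟩ := h
      refine lt_of_le_of_lt ih (Finset.sum_lt_sum (fun t _ => ?_) ⟨s, Finset.mem_univ _, ?_⟩)
      · rw [Function.iterate_succ_apply']
        exact Nat.le_add_right _ _
      · rw [Function.iterate_succ_apply', advance_of_overdemanded hc ho]
        exact Nat.lt_succ_self _
  have h1 := hsum (∑ _s : N, b + 1)
  have h2 := Finset.sum_le_sum fun s (_ : s ∈ Finset.univ) => hle (∑ _s : N, b + 1) s
  omega

-- Otherwise the least preferred holder of `c` would be outranked by at least `q c` others.
open Classical in
theorem IsStable.card_filter_held_le (hr : ∀ c, IsStrictTotalOrder N (r c))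
    (hk : IsStable q r p k) (c : M) :
    (Finset.univ.filter fun s => held p k s = some c).card ≤ q c := by
  by_contra hlt
  have := hr c
  set A := Finset.univ.filter fun s => held p k s = some c with hA
  have hwf : (A : Set N).WellFoundedOn (Function.swap (r c)) :=
    (Finset.finite_toSet _).wellFoundedOn
  have hne : A.Nonempty := by rw [← Finset.card_pos]; omega
  obtain ⟨x, -, hmin⟩ := hwf.has_min (Set.univ : Set (A : Set N))
    ⟨⟨hne.choose, hne.choose_spec⟩, trivial⟩
  have hx : held p k x = some c := (Finset.mem_filter.1 x.2).2
  refine hk.accepted x c hx ?_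
  have hsub : A.erase x ⊆ Finset.univ.filter fun s' => held p k s' = some c ∧ r c s' x := by
    intro y hy
    rw [Finset.mem_erase] at hy
    rw [Finset.mem_filter]
    refine ⟨Finset.mem_univ _, (Finset.mem_filter.1 hy.2).2, ?_⟩
    rcases trichotomous_of (r c) y (x : N) with h | h | h
    · exact h
    · exact absurd h hy.1
    · exact absurd h (hmin ⟨y, hy.2⟩ trivial)
  have h1 := Finset.card_le_card hsub
  rw [Finset.card_erase_of_mem x.2] at h1
  rw [Overdemanded]
  omega

/-- A student matched in the student-optimal stable matching is matched in every stable
matching. -/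
theorem held_ne_none_of_isLeast [Fintype M] (hr : ∀ c, IsStrictTotalOrder N (r c))
    (hp : IsRanking p) (hk : IsLeast {k | IsStable q r p k} k) (hm : IsStable q r p m) {s : N}
    (hs : held p k s ≠ none) : held p m s ≠ none := by
  classical
  intro hsm
  have hkm : k ≤ m := hk.2 hm
  -- A college that loses a student on the way from `k` to `m` has rejected her, so it is full in
  -- `m`.
  have hcol : ∀ c, (Finset.univ.filter fun s => held p k s = some c).card ≤
      (Finset.univ.filter fun s => held p m s = some c).card := by
    intro c
    by_cases hsub : (Finset.univ.filter fun s => held p k s = some c) ⊆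
        (Finset.univ.filter fun s => held p m s = some c)
    · exact Finset.card_le_card hsub
    · obtain ⟨x, hx, hxm⟩ := Finset.not_subset.1 hsub
      simp only [Finset.mem_filter, Finset.mem_univ, true_and] at hx hxm
      have hlt : k x < m x := by
        refine lt_of_le_of_ne (hkm x) fun h => hxm ?_
        rw [held, ← h]
        exact hx
      refine (hk.1.card_filter_held_le hr c).trans
        ((hm.rejected x _ c hlt hx).trans (Finset.card_le_card fun y hy => ?_))
      simp only [Finset.mem_filter, Finset.mem_univ, true_and] at hy ⊢
      exact hy.1
  have hfib : ∀ l : N → ℕ, (Finset.univ.filter fun s => held p l s ≠ none).card =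
      ∑ c, (Finset.univ.filter fun s => held p l s = some c).card := by
    intro l
    rw [← Finset.card_biUnion]
    · congr 1
      ext x
      simp [Option.ne_none_iff_exists']
    · intro c _ c' _ hcc
      refine Finset.disjoint_left.2 fun x hx hx' => hcc ?_
      simp only [Finset.mem_filter, Finset.mem_univ, true_and] at hx hx'
      exact Option.some.inj (hx.symm.trans hx')
  -- Going down the rankings only loses matched students, and `s` is lost; this contradicts the
  -- count by colleges.
  have hss : (Finset.univ.filter fun s => held p m s ≠ none) ⊂
      (Finset.univ.filter fun s => held p k s ≠ none) := by
    refine (Finset.ssubset_iff_of_subset fun x hx => ?_).2 ⟨s, by simpa using hs, by simpa using hsm⟩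
    simp only [Finset.mem_filter, Finset.mem_univ, true_and] at hx ⊢
    exact fun h => hx (hp.eq_none_of_le (hkm x) h)
  have h1 := Finset.card_lt_card hss
  rw [hfib, hfib] at h1
  exact absurd h1 (not_lt.2 (Finset.sum_le_sum fun c _ => hcol c))

/-- Deferred acceptance is strategyproof: no misreport gives a student a college that rejected her
when she was truthful. -/
theorem ne_held_of_isLeast [Fintype M] (hr : ∀ c, IsStrictTotalOrder N (r c))
    {p' : N → ℕ → Option M} {k' : N → ℕ} {s : N} (hp : IsRanking p)
    (hpp' : ∀ t, t ≠ s → p' t = p t)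
    (hk : IsLeast {k | IsStable q r p k} k) (hk' : IsStable q r p' k') {i : ℕ} {c : M}
    (hi : i < k s) (hc : p s i = some c) : held p' k' s ≠ some c := by
  classical
  intro hc'
  -- `pT` truncates the true list of `s` just after `c`; `pL` lists `c` alone. Stability for `pT`
  -- will leave `s` unmatched, whereas `k'` gives her `c`; both matchings are stable for `pL`.
  let pT := Function.update p s fun j => if j ≤ i then p s j else none
  let pL := Function.update p s fun j => if j = 0 then some c else none
  have hpT : IsRanking pT := by
    obtain ⟨b, hb⟩ := hp.exists_bound
    refine ⟨fun t j h => ?_, b, fun t j hj => ?_⟩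
    · by_cases ht : t = s
      · subst ht
        simp only [pT, Function.update_self, ite_eq_right_iff] at h ⊢
        exact fun hj => hp.succ_eq_none t j (h (by omega))
      · simp only [pT, Function.update_of_ne ht] at h ⊢
        exact hp.succ_eq_none t j h
    · by_cases ht : t = s
      · subst ht
        simp only [pT, Function.update_self, ite_eq_right_iff]
        exact fun _ => hb t j hj
      · simp only [pT, Function.update_of_ne ht]
        exact hb t j hj
  have hpL : IsRanking pL := by
    obtain ⟨b, hb⟩ := hp.exists_bound
    refine ⟨fun t j h => ?_, b + 1, fun t j hj => ?_⟩
    · by_cases ht : t = s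
      · subst ht
        simp [pL]
      · simp only [pL, Function.update_of_ne ht] at h ⊢
        exact hp.succ_eq_none t j h
    · by_cases ht : t = s
      · subst ht
        simp only [pL, Function.update_self]
        rw [if_neg (by omega)]
      · simp only [pL, Function.update_of_ne ht]
        exact hb t j (by omega)
  obtain ⟨kT, hkT, -⟩ := exists_isLeast_isStable (q := q) hr hpT
  obtain ⟨kL, hkL⟩ := exists_isLeast_isStable (q := q) hr hpL
  -- If `s` did not exhaust the truncated list, the truncation would be invisible and `kT` stable
  -- for `p`, against the minimality of `k`.
  have hiT : i < kT s := by
    by_contra hle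
    have heq : held p kT = held pT kT := by
      funext t
      by_cases ht : t = s
      · subst ht
        simp only [held, pT, Function.update_self]
        rw [if_pos (by omega)]
      · simp only [held, pT, Function.update_of_ne ht]
    have hst : IsStable q r p kT := by
      refine ⟨fun t j d hj hd => ?_, fun t d hd => ?_⟩
      · rw [heq]
        refine hkT.rejected t j d hj ?_
        by_cases ht : t = s
        · subst ht
          simp only [pT, Function.update_self]
          rw [if_pos (by omega), hd]
        · simpa only [pT, Function.update_of_ne ht] using hd
      · rw [heq] at hd ⊢
        exact hkT.accepted t d hd
    have : k s ≤ kT s := hk.2 hst s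
    omega
  have hTnone : held pT kT s = none := by
    simp only [held, pT, Function.update_self]
    rw [if_neg (by omega)]
  have heqT : held pL (Function.update kT s 1) = held pT kT := by
    funext t
    by_cases ht : t = s
    · subst ht
      rw [hTnone]
      simp [held, pL]
    · simp only [held, pT, pL, Function.update_of_ne ht]
  have hstT : IsStable q r pL (Function.update kT s 1) := by
    refine ⟨fun t j d hj hd => ?_, fun t d hd => ?_⟩
    · rw [heqT]
      by_cases ht : t = s
      · subst ht
        simp only [Function.update_self, Nat.lt_one_iff] at hj
        subst hj
        have hcd : c = d := by simpa [pL] using hd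
        subst hcd
        refine hkT.rejected t i c hiT ?_
        simpa [pT] using hc
      · refine hkT.rejected t j d ?_ ?_
        · simpa only [Function.update_of_ne ht] using hj
        · simpa only [pT, pL, Function.update_of_ne ht] using hd
    · rw [heqT] at hd ⊢
      exact hkT.accepted t d hd
  have heq' : held pL (Function.update k' s 0) = held p' k' := by
    funext t
    by_cases ht : t = s
    · subst ht
      rw [hc']
      simp [held, pL]
    · simp only [held, pL, Function.update_of_ne ht, hpp' t ht]
  have hst' : IsStable q r pL (Function.update k' s 0) := by
    refine ⟨fun t j d hj hd => ?_, fun t d hd => ?_⟩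
    · rw [heq']
      by_cases ht : t = s
      · subst ht
        simp at hj
      · refine hk'.rejected t j d ?_ ?_
        · simpa only [Function.update_of_ne ht] using hj
        · simpa only [pL, Function.update_of_ne ht, hpp' t ht] using hd
    · rw [heq'] at hd ⊢
      exact hk'.accepted t d hd
  have hL0 : kL s = 0 := by simpa using hkL.2 hst' s
  refine held_ne_none_of_isLeast hr hpL hkL hstT (s := s) ?_ ?_
  · simp [held, pL, hL0]
  · rw [heqT, hTnone]

end DeferredAcceptanceWithRankings

/-! ### GDA as deferred acceptance on the proposal lists. -/

section Plan

variable {N M F : Type*} [Fintype M] [Fintype F]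

open Classical in
/-- The set of colleges that have rejected a student after `i` rejections. -/
noncomputable def rejectedAfter (next : NextRule N M F) (s : N) (u : Utilities M F)
    (μ : ProbabilityMeasure (Weights F)) : ℕ → Finset M
  | 0 => ∅
  | i + 1 => rejectedAfter next s u μ i ∪
      if rejectedAfter next s u μ i = Finset.univ then ∅
      else (next s (rejectedAfter next s u μ i) u μ).toFinset

open Classical in
/-- The college to which a student proposes after `i` rejections. -/
noncomputable def plan (next : NextRule N M F) (s : N) (u : Utilities M F)
    (μ : ProbabilityMeasure (Weights F)) (i : ℕ) : Option M :=
  if rejectedAfter next s u μ i = Finset.univ then none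
  else next s (rejectedAfter next s u μ i) u μ

variable {next : NextRule N M F} {s : N} {u : Utilities M F} {μ : ProbabilityMeasure (Weights F)}

open Classical in
theorem rejectedAfter_succ (i : ℕ) : rejectedAfter next s u μ (i + 1) =
    rejectedAfter next s u μ i ∪ (plan next s u μ i).toFinset := by
  rw [rejectedAfter, plan]
  split_ifs <;> rfl

theorem mem_rejectedAfter_iff {i : ℕ} {c : M} :
    c ∈ rejectedAfter next s u μ i ↔ ∃ j < i, plan next s u μ j = some c := by
  classical
  induction i with
  | zero => simp [rejectedAfter]
  | succ i ih =>
    rw [rejectedAfter_succ, Finset.mem_union, ih, Option.mem_toFinset, Option.mem_def]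
    simp only [Nat.lt_succ_iff_lt_or_eq, or_and_right, exists_or, exists_eq_left]

theorem plan_succ_eq_none {i : ℕ} (h : plan next s u μ i = none) :
    plan next s u μ (i + 1) = none := by
  classical
  rw [← h, plan, plan, rejectedAfter_succ, h]
  simp

theorem rejectedAfter_eq_univ_of_plan_eq_none (hv : next.Valid) {i : ℕ}
    (h : plan next s u μ i = none) : rejectedAfter next s u μ i = Finset.univ := by
  by_contra hR
  obtain ⟨c, -, hc⟩ := hv s _ u μ hR
  rw [plan, if_neg hR, hc] at h
  cases h

theorem plan_eq_none_of_card_le (hv : next.Valid) {i : ℕ} (hi : Fintype.card M ≤ i) :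
    plan next s u μ i = none := by
  classical
  have key : ∀ i, rejectedAfter next s u μ i = Finset.univ ∨
      i ≤ (rejectedAfter next s u μ i).card := by
    intro i
    induction i with
    | zero => exact Or.inr (Nat.zero_le _)
    | succ i ih =>
      by_cases hR : rejectedAfter next s u μ i = Finset.univ
      · left
        rw [rejectedAfter_succ, hR]
        exact Finset.eq_univ_iff_forall.2 fun c => Finset.mem_union_left _ (Finset.mem_univ c)
      · right
        obtain ⟨c, hcR, hc⟩ := hv s _ u μ hR
        have := ih.resolve_left hR
        rw [rejectedAfter_succ, plan, if_neg hR, hc, Finset.card_union_of_disjoint (by simpa)]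
        simpa
  have hu : rejectedAfter next s u μ i = Finset.univ := by
    rcases key i with h | h
    · exact h
    · exact (Finset.card_eq_iff_eq_univ _).1 (le_antisymm (Finset.card_le_univ _) (hi.trans h))
  rw [plan, if_pos hu]

theorem isRanking_plan [Fintype N] (hv : next.Valid) (I : Instance N M F) :
    IsRanking fun s => plan next s (I.utility s) (I.dist s) :=
  ⟨fun _ _ h => plan_succ_eq_none h, Fintype.card M, fun _ _ h => plan_eq_none_of_card_le hv h⟩

variable [Fintype N]

theorem GDAState.accepted_iff (I : Instance N M F) (σ : GDAState N M) (c : M) (s : N) :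
    σ.Accepted next I c s ↔ σ.applied next I s = some c ∧
      ¬ Overdemanded I.capacity I.prefers (σ.applied next I) c s := by
  rw [GDAState.Accepted, Overdemanded, not_le]

/-- Generalized deferred acceptance is deferred acceptance with the rankings `plan`. -/
theorem gdaState_eq_iterate_advance (I : Instance N M F) (n : ℕ) :
    let p := fun s => plan next s (I.utility s) (I.dist s)
    let k := (advance I.capacity I.prefers p)^[n] 0
    (∀ s, (gdaState next I n).rejected s =
      rejectedAfter next s (I.utility s) (I.dist s) (k s)) ∧
    (gdaState next I n).applied next I = held p k := by
  classical
  intro p k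
  -- A student just rejected is unmatched in the state, while `held` already points to her next
  -- college; hence the comparison with `applied` rather than `matching`.
  have happ : ∀ (σ : GDAState N M) (l : N → ℕ),
      (∀ s, σ.rejected s = rejectedAfter next s (I.utility s) (I.dist s) (l s)) →
      (∀ s, σ.matching s = none ∨ σ.matching s = p s (l s)) →
      σ.applied next I = held p l := by
    intro σ l hR hm
    funext s
    by_cases hact : σ.Active s
    · have h2 := hact.2
      rw [hR] at h2
      simp only [GDAState.applied, if_pos hact, held, p, plan, if_neg h2, hR]
    · simp only [GDAState.applied, if_neg hact, held]
      rcases hm s with h | h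
      · have hu : σ.rejected s = Finset.univ := by
          by_contra hne
          exact hact ⟨h, hne⟩
        rw [hR] at hu
        simp only [p, plan, if_pos hu, h]
      · exact h
  suffices h : (∀ s, (gdaState next I n).rejected s =
      rejectedAfter next s (I.utility s) (I.dist s) (k s)) ∧
      ∀ s, (gdaState next I n).matching s = none ∨ (gdaState next I n).matching s = p s (k s) from
    ⟨h.1, happ _ _ h.1 h.2⟩
  induction n with
  | zero => exact ⟨fun s => rfl, fun s => Or.inl rfl⟩
  | succ n ih =>
    have ha := happ _ _ ih.1 ih.2
    simp only [k, Function.iterate_succ_apply', gdaState_succ]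
    set l := (advance I.capacity I.prefers p)^[n] 0
    rw [← forall_and]
    intro s
    rcases hs : held p l s with _ | c
    · obtain ⟨h1, h2⟩ := GDAState.round_of_none next I _ ((congrFun ha s).trans hs)
      rw [advance_of_none hs, h2]
      exact ⟨ih.1 s, Or.inl h1⟩
    · have hsc := (congrFun ha s).trans hs
      by_cases ho : Overdemanded I.capacity I.prefers (held p l) c s
      · obtain ⟨h1, h2⟩ := GDAState.round_of_not_accepted next I _ hsc
          (by rw [GDAState.accepted_iff, ha]; exact fun h => h.2 ho)
        rw [advance_of_overdemanded hs ho, h2, rejectedAfter_succ]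
        refine ⟨?_, Or.inl h1⟩
        have hpl : plan next s (I.utility s) (I.dist s) (l s) = some c := hs
        rw [ih.1 s, hpl, Option.toFinset_some]
      · obtain ⟨h1, h2⟩ := GDAState.round_of_accepted next I (gdaState next I n)
          (s := s) (c := c) (by rw [GDAState.accepted_iff, ha]; exact ⟨hs, ho⟩)
        rw [advance_of_not_overdemanded hs ho, h2]
        exact ⟨ih.1 s, Or.inr (h1.trans hs.symm)⟩

/-- The output of generalized deferred acceptance is the student-optimal stable matching for the
rankings `plan`. -/
theorem exists_isLeast_GDA_eq_held (hv : next.Valid) (I : Instance N M F) :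
    ∃ k, IsLeast {k | IsStable I.capacity I.prefers
        (fun s => plan next s (I.utility s) (I.dist s)) k} k ∧
      GDA next I = held (fun s => plan next s (I.utility s) (I.dist s)) k := by
  classical
  set n := Fintype.card N * Fintype.card M
  have happ := (gdaState_eq_iterate_advance (next := next) I n).2
  have heq : GDA next I = (gdaState next I n).applied next I := by
    funext s
    simp only [GDAState.applied, if_neg (gda_terminates hv I s), n, GDA]
  rw [happ] at heq
  refine ⟨_, isLeast_isStable_iterate_advance I.prefers_strict fun s c hs => ?_, heq⟩
  rw [← heq] at hs ⊢
  rw [Overdemanded, not_le]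
  exact gdaState_capacity next I n s c hs

/-- Here `i` is the number of truthful rejections of `s`. Strategyproofness applies since the
misreport changes only her own list. -/
theorem GDA_misreport_notMem_rejectedAfter (hv : next.Valid) (I : Instance N M F) (s : N) :
    ∃ i, GDA next I s = plan next s (I.utility s) (I.dist s) i ∧
      ∀ u' μ' c, GDA next (I.misreport s u' μ') s = some c →
        c ∉ rejectedAfter next s (I.utility s) (I.dist s) i := by
  obtain ⟨k, hk, hkeq⟩ := exists_isLeast_GDA_eq_held hv I
  refine ⟨k s, congrFun hkeq s, fun u' μ' c hc hmem => ?_⟩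
  obtain ⟨k', hk', hkeq'⟩ := exists_isLeast_GDA_eq_held hv (I.misreport s u' μ')
  obtain ⟨j, hj, hjc⟩ := mem_rejectedAfter_iff.1 hmem
  refine ne_held_of_isLeast I.prefers_strict (isRanking_plan hv I) (fun t ht => ?_) hk hk'.1 hj hjc
    ((congrFun hkeq' s).symm.trans hc)
  classical
  simp only [Instance.misreport]
  rw [Function.update_of_ne ht, Function.update_of_ne ht]

end Plan

/-! ### Median weights and the LOICV choice. -/

section TwoFeatures

variable {M F : Type*} [Fintype F]

/-- The infimum of the points where the distribution function is at least 1/2 works: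
right-continuity bounds the lower tail, the left limit the upper one. -/
theorem exists_median (ν : Measure ℝ) [IsProbabilityMeasure ν] :
    ∃ m : ℝ, 1 / 2 ≤ ν.real (Set.Iic m) ∧ 1 / 2 ≤ ν.real (Set.Ici m) := by
  set g := ProbabilityTheory.cdf ν with hg
  let S := {t : ℝ | 1 / 2 ≤ g t}
  have hne : S.Nonempty := ((ProbabilityTheory.tendsto_cdf_atTop ν).eventually
    (eventually_ge_nhds (by norm_num : (1 / 2 : ℝ) < 1))).exists
  have hbdd : BddBelow S := by
    obtain ⟨l, hl⟩ := ((ProbabilityTheory.tendsto_cdf_atBot ν).eventually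
      (eventually_lt_nhds (by norm_num : (0 : ℝ) < 1 / 2))).exists
    exact ⟨l, fun t ht => le_of_not_gt fun h =>
      absurd (ht.trans (ProbabilityTheory.monotone_cdf ν h.le)) (not_le.2 hl)⟩
  refine ⟨sInf S, ?_, ?_⟩
  · rw [← ProbabilityTheory.cdf_eq_real]
    refine ge_of_tendsto (((g.right_continuous (sInf S)).mono Set.Ioi_subset_Ici_self).tendsto)
      (eventually_mem_nhdsWithin.mono fun t ht => ?_)
    obtain ⟨t', ht', hlt⟩ := exists_lt_of_csInf_lt hne ht
    exact le_trans ht' (g.mono hlt.le)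
  · have hlim : Function.leftLim g (sInf S) ≤ 1 / 2 :=
      le_of_tendsto (g.mono.tendsto_leftLim (sInf S)) (eventually_mem_nhdsWithin.mono fun t ht =>
        le_of_not_ge fun h => absurd (csInf_le hbdd h) (not_le.2 ht))
    have hIci := g.measure_Ici (ProbabilityTheory.tendsto_cdf_atTop ν) (sInf S)
    rw [hg, ProbabilityTheory.measure_cdf, ← hg] at hIci
    rw [measureReal_def, hIci, ENNReal.toReal_ofReal (by linarith)]
    linarith

theorem half_le_of_affine (ν : Measure ℝ) [IsProbabilityMeasure ν] {m a b : ℝ}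
    (h₁ : 1 / 2 ≤ ν.real (Set.Iic m)) (h₂ : 1 / 2 ≤ ν.real (Set.Ici m)) (hm : 0 ≤ a * m + b) :
    1 / 2 ≤ ν.real {t | 0 ≤ a * t + b} := by
  rcases le_total 0 a with ha | ha
  · refine h₂.trans (measureReal_mono fun t ht => ?_)
    have := mul_le_mul_of_nonneg_left (Set.mem_Ici.1 ht) ha
    simp only [Set.mem_ofPred_eq]
    linarith
  · refine h₁.trans (measureReal_mono fun t ht => ?_)
    have := mul_le_mul_of_nonpos_left (Set.mem_Iic.1 ht) ha
    simp only [Set.mem_ofPred_eq]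
    linarith

/-- With two features, among any colleges there is one that no other college beats with probability
more than `1 / 2`. -/
theorem exists_half_le_probWeaklyPrefers (hF : Fintype.card F = 2) (u : Utilities M F)
    (μ : ProbabilityMeasure (Weights F)) (S : Finset M) (hS : S.Nonempty) :
    ∃ c ∈ S, ∀ c' ∈ S, 1 / 2 ≤ probWeaklyPrefers u μ c c' := by
  classical
  obtain ⟨f, g, hfg, huniv⟩ := Finset.card_eq_two.1 ((Finset.card_univ (α := F)).trans hF)
  have hmeas : Measurable fun w : Weights F => (w : F → ℝ) f :=
    (measurable_pi_apply f).comp measurable_subtype_coe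
  let ν : Measure ℝ := (μ : Measure (Weights F)).map fun w : Weights F => (w : F → ℝ) f
  have : IsProbabilityMeasure ν := Measure.isProbabilityMeasure_map hmeas.aemeasurable
  obtain ⟨m, h₁, h₂⟩ := exists_median ν
  -- The witness maximizes utility at the median weight `m` of feature `f`.
  obtain ⟨c, hc, hmax⟩ := S.exists_max_image
    (fun c => m * (u f c : ℝ) + (1 - m) * (u g c : ℝ)) hS
  refine ⟨c, hc, fun c' hc' => ?_⟩
  have key := half_le_of_affine ν (a := (u f c : ℝ) - u f c' - (u g c - u g c'))
    (b := (u g c : ℝ) - u g c') h₁ h₂ (by have := hmax c' hc'; linarith)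
  rw [map_measureReal_apply hmeas (measurableSet_le measurable_const (by fun_prop))] at key
  refine key.trans (measureReal_mono fun w hw => ?_)
  have hsum : (w : F → ℝ) f + (w : F → ℝ) g = 1 := by
    have := w.2.2
    rwa [huniv, Finset.sum_pair hfg] at this
  simp only [Set.mem_preimage, Set.mem_ofPred_eq, weightedUtility, huniv,
    Finset.sum_pair hfg] at hw ⊢
  rw [eq_sub_of_add_eq' hsum]
  linarith

/-- An entry below 1/2 would make the head of the sorted vector of `c` smaller than that of the
median-optimal college, against lexicographic maximality. -/
theorem half_le_probWeaklyPrefers_of_isLOICV {N : Type*} [Fintype M] (hF : Fintype.card F = 2)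
    {next : NextRule N M F} (h : IsLOICV next) {s : N} {R : Finset M} {u : Utilities M F}
    {μ : ProbabilityMeasure (Weights F)} (hR : R ≠ Finset.univ) {c c' : M}
    (hc : next s R u μ = some c) (hc' : c' ∉ R) (hne : c' ≠ c) :
    1 / 2 ≤ probWeaklyPrefers u μ c c' := by
  classical
  obtain ⟨c₁, hcR, hc₁, hmax⟩ := h s R u μ hR
  obtain rfl : c₁ = c := Option.some.inj (hc₁.symm.trans hc)
  obtain ⟨d, hd, hbest⟩ := exists_half_le_probWeaklyPrefers hF u μ (Finset.univ.filter (· ∉ R))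
    ⟨c₁, by simpa using hcR⟩
  simp only [Finset.mem_filter, Finset.mem_univ, true_and] at hd hbest
  by_contra hlt
  have hmem : ∀ e x, x ∈ iteratedComparisonVector u μ R e ↔
      ∃ e', (e' ∉ R ∧ e' ≠ e) ∧ probWeaklyPrefers u μ e e' = x := by
    intro e x
    simp [iteratedComparisonVector]
  have hx : probWeaklyPrefers u μ c₁ c' ∈ iteratedComparisonVector u μ R c₁ :=
    (hmem _ _).2 ⟨c', ⟨hc', hne⟩, rfl⟩
  -- The vector of `d` needs a head to compare with; when `d` is `c₁` itself, the rival is `c'`.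
  have hy : ∃ y, y ∈ iteratedComparisonVector u μ R d := by
    by_cases hdc : d = c₁
    · exact ⟨_, (hmem _ _).2 ⟨c', ⟨hc', hdc ▸ hne⟩, rfl⟩⟩
    · exact ⟨_, (hmem _ _).2 ⟨c₁, ⟨hcR, Ne.symm hdc⟩, rfl⟩⟩
  have hsort : (iteratedComparisonVector u μ R c₁).Pairwise (· ≤ ·) := Multiset.pairwise_sort _ _
  refine hmax d hd ?_
  rcases hv : iteratedComparisonVector u μ R c₁ with _ | ⟨a, l⟩
  · simp [hv] at hx
  rcases hw : iteratedComparisonVector u μ R d with _ | ⟨b, l'⟩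
  · simp [hw] at hy
  refine List.Lex.rel (lt_of_lt_of_le (b := (1 / 2 : ℝ)) ?_ ?_)
  · refine lt_of_le_of_lt ?_ (not_le.1 hlt)
    rw [hv] at hx hsort
    rcases List.mem_cons.1 hx with h | h
    · exact h.ge
    · exact List.rel_of_pairwise_cons hsort h
  · obtain ⟨e, he, rfl⟩ := (hmem d b).1 (by rw [hw]; exact List.mem_cons_self)
    exact hbest e he.1

end TwoFeatures

end SchoolChoice

theorem mainTheorem3 {N M F : Type*} [Fintype N] [Fintype M] [Fintype F]
    (hF : Fintype.card F = 2) (next : SchoolChoice.NextRule N M F)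
    (hnext : SchoolChoice.IsLOICV next) :
    SchoolChoice.IsICR (SchoolChoice.GDA next) := by
  open SchoolChoice MeasureTheory in
  intro I s u' μ'
  rw [not_lt]
  obtain ⟨i, hi, hmis⟩ := GDA_misreport_notMem_rejectedAfter hnext.valid I s
  rcases hc' : GDA next (I.misreport s u' μ') s with _ | c'
  · simp [StrictlyBetter]
  have hnot := hmis u' μ' c' hc'
  rcases hc : GDA next I s with _ | c
  -- Truthfully unmatched means rejected by every college, so no misreport can give her one.
  · rw [hc] at hi
    rw [rejectedAfter_eq_univ_of_plan_eq_none hnext.valid hi.symm] at hnot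
    exact absurd (Finset.mem_univ _) hnot
  rw [hc, plan] at hi
  split_ifs at hi with hR
  by_cases hne : c' = c
  · simp [StrictlyBetter, hne]
  have hhalf := half_le_probWeaklyPrefers_of_isLOICV hF hnext hR hi.symm hnot hne
  rw [probWeaklyPrefers] at hhalf
  have hmeas : ∀ d, Measurable fun w : Weights F => weightedUtility (I.utility s) w d := by
    intro d
    refine Finset.measurable_sum _ fun f _ => ?_
    exact ((measurable_pi_apply f).comp measurable_subtype_coe).mul_const _
  have hcompl := probReal_compl_eq_one_sub (μ := (I.dist s : Measure (Weights F)))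
    (measurableSet_le (hmeas c') (hmeas c))
  have hset : {w | StrictlyBetter (I.utility s) w (some c') (some c)} =
      {w | weightedUtility (I.utility s) w c' ≤ weightedUtility (I.utility s) w c}ᶜ := by
    ext w
    simp [StrictlyBetter]
  rw [hset, hcompl]
  linarith
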